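/- Let $\kappa$ be a field, $R=\kappa[x_1,\dots,x_n]$, and $y=x_j$ one of the variables. For $f\in R$ let the initial $y$-form $\mathrm{in}_y f$ be the sum of all terms of $f$ having the highest power of $y$, and for an ideal $J\subseteq R$ let $\mathrm{in}_y J=\langle \mathrm{in}_y f\mid f\in J\rangle$. A monomial order $<$ on $R$ is called $y$-compatible if $\mathrm{in}_< f=\mathrm{in}_<(\mathrm{in}_y f)$ for all $f\in R$. An ideal is squarefree in $y$ if it has a generating set in which $y^2$ divides no term of any element. If $\mathcal G=\{y^{d_i}q_i+r_i\mid 1\le i\le m\}$ is a Gröbner basis of an ideal $I$ with respect to a $y$-compatible order, where $y$ divides no term of any $q_i$ and $\mathrm{in}_y(y^{d_i}q_i+r_i)=y^{d_i}q_i$, put $C_{y,I}=\langle q_1,\dots,q_m\rangle$ and $N_{y,I}=\langle q_i\mid d_i=0\rangle$; these ideals depend neither on the choice of $\mathcal G$ nor on that of the order. The equality $\mathrm{in}_y I=C\cap(N+\langle y\rangle)$ is called a geometric vertex decomposition of $I$ (with respect to $y$) if it holds and $C=C_{y,I}$, $N=N_{y,I}$. **Theorem.** Let $I$, $C$ and $N\subseteq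 I\cap C$ be ideals of $R$, and let $<$ be a $y$-compatible monomial order on $R$. Suppose that $I$ is squarefree in $y$ and that no term of any element of the reduced Gröbner basis of $N$ with respect to $<$ is divisible by $y$. Suppose further that there are $f,g\in R$, neither of whose classes is a zero-divisor on $R/N$, with $\mathrm{in}_y f=y\,g$, and an isomorphism $\varphi\colon C/N\to I/N$ of $R/N$-modules which is multiplication by $f/g$, that is, $g\,\varphi(c)=f\,c$ in $R/N$ for all $c\in C/N$. Then $\mathrm{in}_y I=C\cap(N+\langle y\rangle)$, and this is a geometric vertex decomposition of $I$, i.e. $C=C_{y,I}$ and $N=N_{y,I}$. -/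

import Mathlib

open MvPolynomial

universe u v

namespace GVD

noncomputable section

variable {κ : Type u} [Field κ] {n : ℕ}

/-- The initial `y`-form `in_y f`: the sum of all terms of `f` having the highest power of the
variable `y`. (It is `0` for `f = 0`.) -/
def initForm (y : Fin n) (f : MvPolynomial (Fin n) κ) : MvPolynomial (Fin n) κ :=
  ∑ d ∈ f.support with d y = f.degreeOf y, monomial d (f.coeff d)

/-- The coefficient `q` of the highest power of `y` in `f`, so that `in_y f = y ^ d * q` where `d`
is the degree of `f` in `y`; the variable `y` does not occur in `q`. -/
def initCoeff (y : Fin n) (f : MvPolynomial (Fin n) κ) : MvPolynomial (Fin n) κ :=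
  ∑ d ∈ f.support with d y = f.degreeOf y, monomial (d.erase y) (f.coeff d)

theorem initForm_eq (y : Fin n) (f : MvPolynomial (Fin n) κ) :
    initForm y f = X y ^ f.degreeOf y * initCoeff y f := by
  unfold initForm initCoeff
  rw [Finset.mul_sum]
  refine Finset.sum_congr rfl fun d hd => ?_
  rw [← (Finset.mem_filter.1 hd).2, X_pow_eq_monomial, monomial_mul, one_mul,
    Finsupp.single_add_erase]

/-- The ideal `in_y J` generated by the initial `y`-forms of the elements of `J`. -/
def initIdeal (y : Fin n) (J : Ideal (MvPolynomial (Fin n) κ)) :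
    Ideal (MvPolynomial (Fin n) κ) :=
  Ideal.span (initForm y '' (J : Set (MvPolynomial (Fin n) κ)))

/-- A monomial order is `y`-compatible if `in_< f = in_< (in_y f)` for every polynomial `f` with
coefficients in `κ`. -/
def IsCompatible (κ : Type u) [Field κ] (m : MonomialOrder.{0, v} (Fin n)) (y : Fin n) : Prop :=
  ∀ f : MvPolynomial (Fin n) κ, m.leadingTerm f = m.leadingTerm (initForm y f)

/-- `G` is a (finite) Gröbner basis of the ideal `J`: it is contained in `J`, and the leading terms
of its elements generate the ideal of leading terms of `J`. -/
structure IsGroebnerBasis (m : MonomialOrder.{0, v} (Fin n))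
    (J : Ideal (MvPolynomial (Fin n) κ)) (G : Finset (MvPolynomial (Fin n) κ)) : Prop where
  subset : (G : Set (MvPolynomial (Fin n) κ)) ⊆ J
  span_leadingTerm : Ideal.span (m.leadingTerm '' (G : Set (MvPolynomial (Fin n) κ))) =
    Ideal.span (m.leadingTerm '' (J : Set (MvPolynomial (Fin n) κ)))

/-- Every ideal has a Gröbner basis. -/
theorem exists_isGroebnerBasis (m : MonomialOrder.{0, v} (Fin n))
    (J : Ideal (MvPolynomial (Fin n) κ)) : ∃ G, IsGroebnerBasis m J G := by
  classical
  obtain ⟨T, hT, hspan⟩ := (Submodule.fg_span_iff_fg_span_finset_subset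
    (R := MvPolynomial (Fin n) κ)
    (m.leadingTerm '' (J : Set (MvPolynomial (Fin n) κ)))).1 (IsNoetherian.noetherian _)
  obtain ⟨G, hG, rfl⟩ := Finset.subset_set_image_iff.1 hT
  refine ⟨G, hG, ?_⟩
  rw [Finset.coe_image] at hspan
  exact hspan.symm

/-- `G` is the reduced Gröbner basis of `J`: a Gröbner basis whose elements have leading
coefficient `1`, such that no term of an element of `G` is divisible by the leading monomial of
another element of `G`. -/
structure IsReducedGroebnerBasis (m : MonomialOrder.{0, v} (Fin n))
    (J : Ideal (MvPolynomial (Fin n) κ)) (G : Finset (MvPolynomial (Fin n) κ)) : Prop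
    extends IsGroebnerBasis m J G where
  leadingCoeff_eq_one : ∀ g ∈ G, m.leadingCoeff g = 1
  not_degree_le : ∀ g ∈ G, ∀ h ∈ G, h ≠ g → ∀ d ∈ g.support, ¬ m.degree h ≤ d

/-- The ideal `J` is squarefree in `y`: it has a generating set in which `y ^ 2` does not divide
any term of any element. -/
def IsSquarefreeIn (y : Fin n) (J : Ideal (MvPolynomial (Fin n) κ)) : Prop :=
  ∃ G : Set (MvPolynomial (Fin n) κ), Ideal.span G = J ∧ ∀ g ∈ G, ∀ d ∈ g.support, ¬ 2 ≤ d y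

/-- For `G = {y ^ dᵢ * qᵢ + rᵢ}`, where `y` does not occur in `qᵢ` and the initial `y`-forms are
the `y ^ dᵢ * qᵢ`, the ideal generated by all `qᵢ`. When `G` is a Gröbner basis of `I` for a
`y`-compatible order, this is `C_{y,I}`. -/
def cIdeal (y : Fin n) (G : Finset (MvPolynomial (Fin n) κ)) : Ideal (MvPolynomial (Fin n) κ) :=
  Ideal.span (initCoeff y '' (G : Set (MvPolynomial (Fin n) κ)))

/-- For `G = {y ^ dᵢ * qᵢ + rᵢ}` as in `cIdeal`, the ideal generated by the `qᵢ` with `dᵢ = 0`.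
When `G` is a Gröbner basis of `I` for a `y`-compatible order, this is `N_{y,I}`. -/
def nIdeal (y : Fin n) (G : Finset (MvPolynomial (Fin n) κ)) : Ideal (MvPolynomial (Fin n) κ) :=
  Ideal.span (initCoeff y '' {g ∈ (G : Set (MvPolynomial (Fin n) κ)) | g.degreeOf y = 0})

/-- `in_y I = C ∩ (N + ⟨y⟩)` is a geometric vertex decomposition of `I` with respect to `y`: the
equality holds, and `C = C_{y,I}` and `N = N_{y,I}`, where the latter ideals may be computed from
any Gröbner basis of `I` with respect to any `y`-compatible monomial order. -/
structure IsGeometricVertexDecomposition (y : Fin n)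
    (I C N : Ideal (MvPolynomial (Fin n) κ)) : Prop where
  initIdeal_eq : initIdeal y I = C ⊓ (N ⊔ Ideal.span {X y})
  eq_ideals : ∀ m : MonomialOrder.{0, v} (Fin n), IsCompatible κ m y →
    ∀ G : Finset (MvPolynomial (Fin n) κ), IsGroebnerBasis m I G →
      C = cIdeal y G ∧ N = nIdeal y G

/-- For a ring `R`, ideals `I, C, N` and `f, g ∈ R`: an `R/N`-linear isomorphism from the image
of `C` in `R/N` to the image of `I` in `R/N` (these are `C/N` and `I/N` when `N ⊆ I ∩ C`) is
multiplication by `f/g` if it sends the class of `c` to a class `i` with `g * i = f * c` in `R/N`.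
When `g` is not a zero-divisor on `R/N`, this determines `i`. -/
def IsMulByFraction {R : Type u} [CommRing R] {I C N : Ideal R}
    (φ : C.map (Ideal.Quotient.mk N) ≃ₗ[R ⧸ N] I.map (Ideal.Quotient.mk N)) (f g : R) : Prop :=
  ∀ c : C.map (Ideal.Quotient.mk N),
    Ideal.Quotient.mk N g * (φ c : R ⧸ N) = Ideal.Quotient.mk N f * (c : R ⧸ N)

end

end GVD

/-!
Every polynomial is expanded in powers of `y` (`yExpand`), and the coefficients are reduced modulo
`N` (`yExpandMod`). Since `N` has a Gröbner basis not involving `y`, this embeds `R / N` into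
`(R / N)[T]`.

The isomorphism enters only through the relation `g * i = f * c` modulo `N`, which matches the
elements `c ∈ C` with the elements `i ∈ I` (`IsFractionCorrespondence`). Write
`in_y f = y ^ (d + 1) * q` and `g = y ^ d * q`. The class of `q` is not a zero-divisor, because it
divides that of `g`; so comparing the coefficients in the relation shows that passing from `c` to
`i` raises the degree in `y` modulo `N` by exactly one and keeps the leading coefficient
(`yExpandMod_of_mul_eq_mul`). All else follows from this.

* The generators of `I` have degree at most one in `y`, so they come from elements of `C` that have
  degree zero modulo `N`; hence `C` is generated by polynomials not involving `y`
  (`IsFractionCorrespondence.isExtended_right`).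
* The leading coefficient of an element of `I` lies in `C`, and even in `N` if the degree in `y` is
  zero (`IsFractionCorrespondence.initCoeff_mem`). Conversely, each `q ∈ C` not involving `y` is the
  coefficient of `y` in some `y * q + r ∈ I` (`IsFractionCorrespondence.exists_mem_left`). Together
  these give `in_y I = N + y C = C ∩ (N + ⟨y⟩)`.
* For any Gröbner basis of `I` with respect to a `y`-compatible order, division with remainder
  expresses the leading coefficients of elements of `I` by those of the basis
  (`IsGroebnerBasis.coeff_yExpand_mem`), which identifies `C` and `N` with `C_{y,I}` and `N_{y,I}`.
-/

/-! ### Expansion in powers of `y` -/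

namespace GVD

section Expansion

variable {κ : Type u} [Field κ] {n : ℕ}

/-- The expansion of a polynomial in powers of the variable `y`, as a polynomial in one new
variable that takes the place of `y`. The coefficients are kept in the original ring, where they
are polynomials not involving `y`. -/
noncomputable def yExpand (y : Fin n) :
    MvPolynomial (Fin n) κ →ₐ[κ] Polynomial (MvPolynomial (Fin n) κ) :=
  aeval fun i => if i = y then Polynomial.X else Polynomial.C (X i)

theorem yExpand_X_self (y : Fin n) :
    yExpand y (X y : MvPolynomial (Fin n) κ) = Polynomial.X := by
  simp [yExpand]

theorem eval_yExpand (y : Fin n) (f : MvPolynomial (Fin n) κ) :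
    (yExpand y f).eval (X y) = f := by
  have h : ((Polynomial.aeval (X y : MvPolynomial (Fin n) κ)).restrictScalars κ).comp
      (yExpand y) = AlgHom.id κ _ := by
    ext i : 1
    by_cases hi : i = y <;> simp [yExpand, hi]
  simpa [Polynomial.aeval_def, Polynomial.eval₂_eq_eval_map] using DFunLike.congr_fun h f

theorem eq_sum_coeff_yExpand (y : Fin n) (f : MvPolynomial (Fin n) κ) :
    f = ∑ k ∈ Finset.range ((yExpand y f).natDegree + 1), (yExpand y f).coeff k * X y ^ k := by
  conv_lhs => rw [← eval_yExpand y f, Polynomial.eval_eq_sum_range]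

theorem yExpand_monomial_of_eq_zero (y : Fin n) {d : Fin n →₀ ℕ} (hd : d y = 0) (a : κ) :
    yExpand y (monomial d a) = Polynomial.C (monomial d a) := by
  have h : ∀ i, (if i = y then Polynomial.X else
      Polynomial.C (X i : MvPolynomial (Fin n) κ)) ^ d i = Polynomial.C (X i) ^ d i := by
    intro i
    by_cases hi : i = y
    · subst hi; simp [hd]
    · simp [hi]
  rw [yExpand, aeval_monomial, monomial_eq]
  simp only [Finsupp.prod, h, map_mul, map_prod, map_pow]
  rfl

theorem yExpand_monomial (y : Fin n) (d : Fin n →₀ ℕ) (a : κ) :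
    yExpand y (monomial d a) = Polynomial.monomial (d y) (monomial (d.erase y) a) := by
  have h : (monomial d a : MvPolynomial (Fin n) κ) = monomial (d.erase y) a * X y ^ d y := by
    rw [X_pow_eq_monomial, monomial_mul, mul_one, Finsupp.erase_add_single]
  rw [h, map_mul, map_pow, yExpand_X_self,
    yExpand_monomial_of_eq_zero y (Finsupp.erase_same), Polynomial.C_mul_X_pow_eq_monomial]

theorem coeff_yExpand (y : Fin n) (f : MvPolynomial (Fin n) κ) (k : ℕ) :
    (yExpand y f).coeff k = ∑ d ∈ f.support with d y = k, monomial (d.erase y) (f.coeff d) := by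
  conv_lhs => rw [f.as_sum, map_sum, Polynomial.finsetSum_coeff]
  simp [yExpand_monomial, Polynomial.coeff_monomial, Finset.sum_filter]

/-- The coefficients of the expansion do not involve `y`. -/
theorem yExpand_coeff_yExpand (y : Fin n) (f : MvPolynomial (Fin n) κ) (k : ℕ) :
    yExpand y ((yExpand y f).coeff k) = Polynomial.C ((yExpand y f).coeff k) := by
  rw [coeff_yExpand, map_sum, map_sum]
  exact Finset.sum_congr rfl fun d _ => yExpand_monomial_of_eq_zero y Finsupp.erase_same _

theorem initCoeff_eq_coeff (y : Fin n) (f : MvPolynomial (Fin n) κ) :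
    initCoeff y f = (yExpand y f).coeff (f.degreeOf y) := by
  rw [coeff_yExpand]; rfl

theorem coeff_initForm (y : Fin n) (f : MvPolynomial (Fin n) κ) {d : Fin n →₀ ℕ}
    (hd : d y = f.degreeOf y) : (initForm y f).coeff d = f.coeff d := by
  simp only [initForm, coeff_sum, coeff_monomial]
  rw [Finset.sum_ite_eq']
  by_cases h : d ∈ f.support
  · simp [h, hd]
  · simp [h, notMem_support_iff.1 h]

theorem apply_eq_degreeOf_of_mem_support_initForm (y : Fin n) (f : MvPolynomial (Fin n) κ)
    {d : Fin n →₀ ℕ} (hd : d ∈ (initForm y f).support) : d y = f.degreeOf y := by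
  by_contra h
  refine mem_support_iff.1 hd ?_
  simp only [initForm, coeff_sum, coeff_monomial]
  rw [Finset.sum_ite_eq', if_neg]
  simp [h]

theorem initForm_ne_zero (y : Fin n) {f : MvPolynomial (Fin n) κ} (hf : f ≠ 0) :
    initForm y f ≠ 0 := by
  obtain ⟨d, hd, h⟩ := Finset.exists_mem_eq_sup f.support (support_nonempty.2 hf) fun d => d y
  rw [← degreeOf_eq_sup] at h
  intro h0
  have := coeff_initForm y f h.symm
  rw [h0, coeff_zero] at this
  exact mem_support_iff.1 hd this.symm

theorem natDegree_yExpand (y : Fin n) (f : MvPolynomial (Fin n) κ) :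
    (yExpand y f).natDegree = f.degreeOf y := by
  by_cases hf : f = 0
  · simp [hf]
  refine le_antisymm ?_ (Polynomial.le_natDegree_of_ne_zero fun h => ?_)
  · rw [Polynomial.natDegree_le_iff_coeff_eq_zero]
    intro k hk
    rw [coeff_yExpand, Finset.filter_false_of_mem, Finset.sum_empty]
    rintro d hd rfl
    exact hk.not_ge (monomial_le_degreeOf y hd)
  · rw [← initCoeff_eq_coeff] at h
    exact initForm_ne_zero y hf (by rw [initForm_eq, h, mul_zero])

theorem initCoeff_eq_leadingCoeff (y : Fin n) (f : MvPolynomial (Fin n) κ) :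
    initCoeff y f = (yExpand y f).leadingCoeff := by
  rw [initCoeff_eq_coeff, Polynomial.leadingCoeff, natDegree_yExpand]

theorem yExpand_eq_C_of_degreeOf_eq_zero (y : Fin n) {f : MvPolynomial (Fin n) κ}
    (hf : f.degreeOf y = 0) : yExpand y f = Polynomial.C f := by
  rw [← natDegree_yExpand] at hf
  rw [Polynomial.eq_C_of_natDegree_eq_zero hf]
  congr 1
  conv_rhs => rw [← eval_yExpand y f, Polynomial.eq_C_of_natDegree_eq_zero hf, Polynomial.eval_C]

/-! ### Ideals generated by polynomials not involving `y` -/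

/-- An ideal is extended along `y` if it contains, with each polynomial, all coefficients of its
expansion in powers of `y`; equivalently, it is generated by polynomials not involving `y`. -/
def IsExtended (y : Fin n) (J : Ideal (MvPolynomial (Fin n) κ)) : Prop :=
  ∀ h ∈ J, ∀ k, (yExpand y h).coeff k ∈ J

theorem isExtended_span (y : Fin n) {S : Set (MvPolynomial (Fin n) κ)}
    (hS : ∀ s ∈ S, ∀ k, (yExpand y s).coeff k ∈ Ideal.span S) :
    IsExtended y (Ideal.span S) := by
  have h : Ideal.span S ≤ ((Ideal.span S).map Polynomial.C).comap (yExpand y) :=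
    Ideal.span_le.2 fun s hs => Ideal.mem_comap.2 (Ideal.mem_map_C_iff.2 (hS s hs))
  exact fun x hx => Ideal.mem_map_C_iff.1 (Ideal.mem_comap.1 (h hx))

theorem mem_of_coeff_yExpand_mem (y : Fin n) {J : Ideal (MvPolynomial (Fin n) κ)}
    {h : MvPolynomial (Fin n) κ} (hh : ∀ k, (yExpand y h).coeff k ∈ J) : h ∈ J := by
  rw [eq_sum_coeff_yExpand y h]
  exact J.sum_mem fun k _ => J.mul_mem_right _ (hh k)

end Expansion

/-! ### Gröbner bases and `y`-compatible orders -/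

section Groebner

variable {κ : Type u} [Field κ] {n : ℕ} {m : MonomialOrder.{0, v} (Fin n)}

/-- Division with remainder zero: an element of an ideal is a combination of a Gröbner basis
in which no summand has a larger leading monomial. -/
theorem IsGroebnerBasis.exists_linearCombination {J : Ideal (MvPolynomial (Fin n) κ)}
    {G : Finset (MvPolynomial (Fin n) κ)} (hG : IsGroebnerBasis m J G)
    {h : MvPolynomial (Fin n) κ} (hh : h ∈ J) :
    ∃ p : ((G : Set (MvPolynomial (Fin n) κ)) \ {0} : Set _) →₀ MvPolynomial (Fin n) κ,
      h = Finsupp.linearCombination _ Subtype.val p ∧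
      ∀ b : ((G : Set (MvPolynomial (Fin n) κ)) \ {0} : Set _),
        m.toSyn (m.degree ((b : MvPolynomial (Fin n) κ) * p b)) ≤ m.toSyn (m.degree h) := by
  obtain ⟨p, r, hpr, hdeg, hr⟩ := m.div_set (B := (G : Set (MvPolynomial (Fin n) κ)) \ {0})
    (fun b hb => m.isUnit_leadingCoeff.2 hb.2) h
  refine ⟨p, ?_, hdeg⟩
  suffices r = 0 by rw [hpr, this, add_zero]
  by_contra hr0
  have hrJ : r ∈ J := by
    rw [← sub_eq_of_eq_add' hpr]
    exact J.sub_mem hh (Submodule.sum_mem _ fun b _ => J.mul_mem_left _ (hG.subset b.2.1))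
  -- The leading monomial of the remainder would be divisible by that of an element of `G`.
  have hlt : m.leadingTerm r ∈
      Ideal.span (m.leadingTerm '' (G : Set (MvPolynomial (Fin n) κ))) := by
    rw [hG.span_leadingTerm]
    exact Ideal.subset_span ⟨r, hrJ, rfl⟩
  rw [m.span_leadingTerm_eq_span_monomial',
    ← Set.image_image (fun d => monomial d (1 : κ)) m.degree,
    mem_ideal_span_monomial_image] at hlt
  obtain ⟨-, ⟨b, hb, rfl⟩, hle⟩ := hlt (m.degree r) (by
    rw [m.support_leadingTerm' hr0, Finset.mem_singleton])
  exact hr _ (m.degree_mem_support hr0) b hb hle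

theorem IsGroebnerBasis.span_eq {J : Ideal (MvPolynomial (Fin n) κ)}
    {G : Finset (MvPolynomial (Fin n) κ)} (hG : IsGroebnerBasis m J G) :
    Ideal.span (G : Set (MvPolynomial (Fin n) κ)) = J := by
  refine le_antisymm (Ideal.span_le.2 hG.subset) fun h hh => ?_
  obtain ⟨p, rfl, -⟩ := hG.exists_linearCombination hh
  exact Submodule.sum_mem _ fun b _ => Ideal.mul_mem_left _ _ (Ideal.subset_span b.2.1)

theorem IsCompatible.degree_apply {y : Fin n} (hm : IsCompatible κ m y)
    {f : MvPolynomial (Fin n) κ} (hf : f ≠ 0) : m.degree f y = f.degreeOf y := by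
  apply apply_eq_degreeOf_of_mem_support_initForm
  have h : m.degree f = m.degree (initForm y f) := by
    rw [← m.degree_leadingTerm, hm f, m.degree_leadingTerm]
  rw [h]
  exact m.degree_mem_support (initForm_ne_zero y hf)

/-- A `y`-compatible order compares the degrees in `y` first. -/
theorem IsCompatible.degreeOf_le {y : Fin n} (hm : IsCompatible κ m y)
    {p q : MvPolynomial (Fin n) κ} (hp : p ≠ 0) (hq : q ≠ 0)
    (h : m.toSyn (m.degree p) ≤ m.toSyn (m.degree q)) : p.degreeOf y ≤ q.degreeOf y := by
  -- If `p` is strictly smaller, then `q + p` has the leading monomial of `q`, hence its degree in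
  -- `y`, and `p = (q + p) - q` cannot have a larger one.
  rcases h.eq_or_lt with h | h
  · rw [← hm.degree_apply hp, ← hm.degree_apply hq, m.toSyn.injective h]
  · have hd := m.degree_add_of_lt h
    have h0 : q + p ≠ 0 := by
      intro h0
      rw [eq_neg_of_add_eq_zero_left h0, m.degree_neg] at h
      exact h.false
    have hs : (q + p).degreeOf y = q.degreeOf y := by
      rw [← hm.degree_apply h0, ← hm.degree_apply hq, hd]
    have := degreeOf_sub_le y (q + p) q
    rwa [hs, max_self, add_sub_cancel_left] at this

/-- If `h` belongs to an ideal with Gröbner basis `G` and has degree at most `k` in `y`, then the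
coefficient of `y ^ k` in `h` is a combination of the leading coefficients, as polynomials in `y`,
of those elements of `G` whose degree in `y` is at most `k`. -/
theorem IsGroebnerBasis.coeff_yExpand_mem {y : Fin n} (hm : IsCompatible κ m y)
    {J : Ideal (MvPolynomial (Fin n) κ)} {G : Finset (MvPolynomial (Fin n) κ)}
    (hG : IsGroebnerBasis m J G) {h : MvPolynomial (Fin n) κ} (hh : h ∈ J) {k : ℕ}
    (hk : h.degreeOf y ≤ k) :
    (yExpand y h).coeff k ∈ Ideal.span
      (initCoeff y '' {g ∈ (G : Set (MvPolynomial (Fin n) κ)) | g.degreeOf y ≤ k}) := by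
  by_cases h0 : h = 0
  · simp [h0]
  obtain ⟨p, hsum, hdeg⟩ := hG.exists_linearCombination hh
  rw [hsum, Finsupp.linearCombination_apply, Finsupp.sum, map_sum, Polynomial.finsetSum_coeff]
  refine Ideal.sum_mem _ fun b hb => ?_
  have hpb : p b ≠ 0 := Finsupp.mem_support_iff.1 hb
  have hb0 : (b : MvPolynomial (Fin n) κ) ≠ 0 := b.2.2
  have hle := (hm.degreeOf_le (mul_ne_zero hb0 hpb) h0 (hdeg b)).trans hk
  rw [degreeOf_mul_eq hb0 hpb] at hle
  obtain ⟨j, rfl⟩ := Nat.exists_eq_add_of_le' (le_of_add_le_left hle)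
  rw [smul_eq_mul, map_mul, Polynomial.coeff_mul_add_eq_of_natDegree_le
    (by rw [natDegree_yExpand]; omega) (natDegree_yExpand y _).le, ← initCoeff_eq_coeff]
  exact Ideal.mul_mem_left _ _ (Ideal.subset_span ⟨b, ⟨b.2.1, by simp⟩, rfl⟩)

end Groebner

/-! ### Multiplication by `f / g` -/

section Fraction

variable {κ : Type u} [Field κ] {n : ℕ} {y : Fin n} {N : Ideal (MvPolynomial (Fin n) κ)}

/-- The expansion in powers of `y` with coefficients reduced modulo `N`. -/
noncomputable def yExpandMod (y : Fin n) (N : Ideal (MvPolynomial (Fin n) κ)) :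
    MvPolynomial (Fin n) κ →+* Polynomial (MvPolynomial (Fin n) κ ⧸ N) :=
  (Polynomial.mapRingHom (Ideal.Quotient.mk N)).comp (yExpand y).toRingHom

theorem coeff_yExpandMod (h : MvPolynomial (Fin n) κ) (k : ℕ) :
    (yExpandMod y N h).coeff k = Ideal.Quotient.mk N ((yExpand y h).coeff k) := by
  simp [yExpandMod]

theorem natDegree_yExpandMod_le (h : MvPolynomial (Fin n) κ) :
    (yExpandMod y N h).natDegree ≤ h.degreeOf y := by
  rw [← natDegree_yExpand]
  exact Polynomial.natDegree_map_le

theorem yExpandMod_eq_zero_iff (hN : IsExtended y N) {h : MvPolynomial (Fin n) κ} :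
    yExpandMod y N h = 0 ↔ h ∈ N := by
  simp only [Polynomial.ext_iff, coeff_yExpandMod, Polynomial.coeff_zero,
    Ideal.Quotient.eq_zero_iff_mem]
  exact ⟨mem_of_coeff_yExpand_mem y, hN h⟩

/-- If `i = (f / g) * c` modulo `N` and `c` has degree at most `e` in `y` modulo `N`, then `i` has
degree at most `e + 1`, and the coefficients of `y ^ (e + 1)` in `i` and of `y ^ e` in `c` agree.
The reason is that `g = y ^ d * q` and `f = y ^ (d + 1) * q + ⋯`, where `q` is not a zero-divisor
modulo `N`. -/
theorem yExpandMod_of_mul_eq_mul (hN : IsExtended y N) {f g : MvPolynomial (Fin n) κ}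
    (hf : Ideal.Quotient.mk N f ∈ nonZeroDivisors (MvPolynomial (Fin n) κ ⧸ N))
    (hg : Ideal.Quotient.mk N g ∈ nonZeroDivisors (MvPolynomial (Fin n) κ ⧸ N))
    (hfg : initForm y f = X y * g) {c i : MvPolynomial (Fin n) κ}
    (h : Ideal.Quotient.mk N g * Ideal.Quotient.mk N i =
      Ideal.Quotient.mk N f * Ideal.Quotient.mk N c) {e : ℕ}
    (he : (yExpandMod y N c).natDegree ≤ e) :
    (yExpandMod y N i).natDegree ≤ e + 1 ∧
      (yExpandMod y N i).coeff (e + 1) = (yExpandMod y N c).coeff e := by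
  have hmul : yExpandMod y N g * yExpandMod y N i = yExpandMod y N f * yExpandMod y N c := by
    rw [← map_mul, ← map_mul, ← sub_eq_zero, ← map_sub, yExpandMod_eq_zero_iff hN,
      ← Ideal.Quotient.eq_zero_iff_mem, map_sub, map_mul, map_mul, h, sub_self]
  rw [initForm_eq] at hfg
  have hqC : yExpand y (initCoeff y f) = Polynomial.C (initCoeff y f) := by
    rw [initCoeff_eq_coeff, yExpand_coeff_yExpand]
  rcases hd : f.degreeOf y with _ | d
  · -- Here `y` divides a polynomial not involving `y`, so `f = 0` and `N` is the unit ideal.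
    have h1 := congrArg (fun p => (yExpand y p).coeff 0) hfg
    simp only [hd, pow_zero, one_mul, hqC, map_mul, yExpand_X_self, Polynomial.coeff_C_zero,
      Polynomial.mul_coeff_zero, Polynomial.coeff_X_zero, zero_mul] at h1
    rw [initCoeff_eq_leadingCoeff, yExpand_eq_C_of_degreeOf_eq_zero y hd,
      Polynomial.leadingCoeff_C] at h1
    rw [h1, map_zero] at hf
    have : Subsingleton (MvPolynomial (Fin n) κ ⧸ N) :=
      subsingleton_of_zero_eq_one (hf.1 1 (by simp)).symm
    have : Subsingleton (Polynomial (MvPolynomial (Fin n) κ ⧸ N)) := inferInstance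
    rw [Subsingleton.elim (yExpandMod y N i) 0, Subsingleton.elim (yExpandMod y N c) 0]
    simp
  set q := initCoeff y f with hq
  have hgq : g = X y ^ d * q := by
    rw [hd, pow_succ', mul_assoc] at hfg
    exact (mul_left_cancel₀ (X_ne_zero y) hfg).symm
  have hqN : ∀ a, Ideal.Quotient.mk N q * a = 0 → a = 0 := fun a ha =>
    hg.1 a (by rw [hgq, map_mul, mul_assoc, ha, mul_zero])
  have hleft : ∀ k, (yExpandMod y N g * yExpandMod y N i).coeff (k + d) =
      Ideal.Quotient.mk N q * (yExpandMod y N i).coeff k := by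
    intro k
    have : yExpandMod y N g = Polynomial.X ^ d * Polynomial.C (Ideal.Quotient.mk N q) := by
      simp [yExpandMod, hgq, yExpand_X_self, hqC]
    rw [this, mul_assoc, Polynomial.coeff_X_pow_mul, Polynomial.coeff_C_mul]
  have hfdeg : (yExpandMod y N f).natDegree ≤ d + 1 := hd ▸ natDegree_yExpandMod_le f
  constructor
  · rw [Polynomial.natDegree_le_iff_coeff_eq_zero]
    intro k hk
    apply hqN
    rw [← hleft, hmul]
    refine Polynomial.coeff_eq_zero_of_natDegree_lt (Polynomial.natDegree_mul_le.trans_lt ?_)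
    omega
  · have h1 := hleft (e + 1)
    rw [hmul, show e + 1 + d = d + 1 + e by ring,
      Polynomial.coeff_mul_add_eq_of_natDegree_le hfdeg he, coeff_yExpandMod f, ← hd,
      ← initCoeff_eq_coeff, ← hq] at h1
    rw [← sub_eq_zero]
    exact hqN _ (by rw [mul_sub, ← h1, sub_self])

/-- Modulo `N`, the ideals `I` and `C` correspond to each other under multiplication by `f / g`.
The correspondence is recorded as a relation between representatives in the polynomial ring; it is
linear and bijective modulo `N` because `f` and `g` are not zero-divisors there. -/
structure IsFractionCorrespondence (y : Fin n) (I C N : Ideal (MvPolynomial (Fin n) κ))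
    (f g : MvPolynomial (Fin n) κ) : Prop where
  isExtended : IsExtended y N
  le_left : N ≤ I
  le_right : N ≤ C
  num_mem : Ideal.Quotient.mk N f ∈ nonZeroDivisors (MvPolynomial (Fin n) κ ⧸ N)
  den_mem : Ideal.Quotient.mk N g ∈ nonZeroDivisors (MvPolynomial (Fin n) κ ⧸ N)
  initForm_num : initForm y f = X y * g
  exists_left : ∀ c ∈ C, ∃ i ∈ I, Ideal.Quotient.mk N g * Ideal.Quotient.mk N i =
    Ideal.Quotient.mk N f * Ideal.Quotient.mk N c
  exists_right : ∀ i ∈ I, ∃ c ∈ C, Ideal.Quotient.mk N g * Ideal.Quotient.mk N i =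
    Ideal.Quotient.mk N f * Ideal.Quotient.mk N c

theorem isFractionCorrespondence_of_isMulByFraction {I C N : Ideal (MvPolynomial (Fin n) κ)}
    (hNI : N ≤ I) (hNC : N ≤ C) (hN : IsExtended y N) {f g : MvPolynomial (Fin n) κ}
    (hf : Ideal.Quotient.mk N f ∈ nonZeroDivisors (MvPolynomial (Fin n) κ ⧸ N))
    (hg : Ideal.Quotient.mk N g ∈ nonZeroDivisors (MvPolynomial (Fin n) κ ⧸ N))
    (hfg : initForm y f = X y * g)
    (φ : C.map (Ideal.Quotient.mk N) ≃ₗ[MvPolynomial (Fin n) κ ⧸ N]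
      I.map (Ideal.Quotient.mk N))
    (hφ : IsMulByFraction φ f g) : IsFractionCorrespondence y I C N f g where
  isExtended := hN
  le_left := hNI
  le_right := hNC
  num_mem := hf
  den_mem := hg
  initForm_num := hfg
  exists_left c hc := by
    obtain ⟨i, hi, h⟩ := (Ideal.mem_map_iff_of_surjective _ Ideal.Quotient.mk_surjective).1
      (φ ⟨_, Ideal.mem_map_of_mem _ hc⟩).2
    exact ⟨i, hi, h ▸ hφ ⟨_, Ideal.mem_map_of_mem _ hc⟩⟩
  exists_right i hi := by
    have h1 := hφ (φ.symm ⟨_, Ideal.mem_map_of_mem _ hi⟩)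
    obtain ⟨c, hc, h⟩ := (Ideal.mem_map_iff_of_surjective _ Ideal.Quotient.mk_surjective).1
      (φ.symm ⟨_, Ideal.mem_map_of_mem _ hi⟩).2
    rw [← h, φ.apply_symm_apply] at h1
    exact ⟨c, hc, h1⟩

namespace IsFractionCorrespondence

variable {I C : Ideal (MvPolynomial (Fin n) κ)} {f g : MvPolynomial (Fin n) κ}

theorem right_mem_of_left_mem (H : IsFractionCorrespondence y I C N f g)
    {c i : MvPolynomial (Fin n) κ} (hi : i ∈ N)
    (h : Ideal.Quotient.mk N g * Ideal.Quotient.mk N i =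
      Ideal.Quotient.mk N f * Ideal.Quotient.mk N c) : c ∈ N := by
  rw [Ideal.Quotient.eq_zero_iff_mem.2 hi, mul_zero] at h
  exact Ideal.Quotient.eq_zero_iff_mem.1 (H.num_mem.1 _ h.symm)

theorem left_mem_of_right_mem (H : IsFractionCorrespondence y I C N f g)
    {c i : MvPolynomial (Fin n) κ} (hc : c ∈ N)
    (h : Ideal.Quotient.mk N g * Ideal.Quotient.mk N i =
      Ideal.Quotient.mk N f * Ideal.Quotient.mk N c) : i ∈ N := by
  rw [Ideal.Quotient.eq_zero_iff_mem.2 hc, mul_zero] at h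
  exact Ideal.Quotient.eq_zero_iff_mem.1 (H.den_mem.1 _ h)

/-- Multiplication by `f / g` raises the degree in `y` modulo `N`. -/
theorem natDegree_lt (H : IsFractionCorrespondence y I C N f g)
    {c i : MvPolynomial (Fin n) κ} (hc : c ∉ N)
    (h : Ideal.Quotient.mk N g * Ideal.Quotient.mk N i =
      Ideal.Quotient.mk N f * Ideal.Quotient.mk N c) :
    (yExpandMod y N c).natDegree < i.degreeOf y := by
  refine (Nat.lt_of_succ_le (Polynomial.le_natDegree_of_ne_zero ?_)).trans_le
    (natDegree_yExpandMod_le (N := N) i)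
  rw [Nat.succ_eq_add_one, (yExpandMod_of_mul_eq_mul H.isExtended H.num_mem H.den_mem
    H.initForm_num h le_rfl).2]
  exact Polynomial.leadingCoeff_ne_zero.2 fun h0 => hc ((yExpandMod_eq_zero_iff H.isExtended).1 h0)

/-- The generators of `I` that witness squarefreeness in `y` correspond to elements of `C` of
degree `0` in `y` modulo `N`, so `C` is generated by `N` and polynomials not involving `y`. -/
theorem isExtended_right (H : IsFractionCorrespondence y I C N f g) (hI : IsSquarefreeIn y I) :
    IsExtended y C := by
  obtain ⟨G, rfl, hG⟩ := hI
  set S : Set (MvPolynomial (Fin n) κ) :=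
    {c | c ∈ C ∧ ∀ k, 1 ≤ k → (yExpand y c).coeff k ∈ N} with hS
  have hNS : N ≤ Ideal.span S := fun x hx =>
    Ideal.subset_span ⟨H.le_right hx, fun k _ => H.isExtended x hx k⟩
  have key : ∀ i ∈ Ideal.span G, ∀ c ∈ C, Ideal.Quotient.mk N g * Ideal.Quotient.mk N i =
      Ideal.Quotient.mk N f * Ideal.Quotient.mk N c → c ∈ Ideal.span S := by
    intro i hi
    induction hi using Submodule.span_induction with
    | mem i hi =>
      intro c hc h
      by_cases hcN : c ∈ N
      · exact hNS hcN
      refine Ideal.subset_span ⟨hc, fun k hk => ?_⟩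
      rw [← Ideal.Quotient.eq_zero_iff_mem, ← coeff_yExpandMod]
      apply Polynomial.coeff_eq_zero_of_natDegree_lt
      have h1 := H.natDegree_lt hcN h
      have h2 : i.degreeOf y ≤ 1 :=
        (degreeOf_le_iff).2 fun d hd => Nat.le_of_lt_succ (not_le.1 (hG i hi d hd))
      omega
    | zero => exact fun c _ h => hNS (H.right_mem_of_left_mem N.zero_mem h)
    | add i j hi hj ihi ihj =>
      intro c hc h
      obtain ⟨a, ha, hia⟩ := H.exists_right i hi
      obtain ⟨b, hb, hjb⟩ := H.exists_right j hj
      have hd : c - (a + b) ∈ N := H.right_mem_of_left_mem N.zero_mem (by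
        rw [map_sub, map_add, mul_sub, mul_add, ← h, ← hia, ← hjb, ← mul_add, ← map_add,
          sub_self, map_zero, mul_zero])
      rw [← sub_add_cancel c (a + b)]
      exact add_mem (hNS hd) (add_mem (ihi a ha hia) (ihj b hb hjb))
    | smul r i hi ih =>
      intro c hc h
      obtain ⟨a, ha, hia⟩ := H.exists_right i hi
      have hd : c - r * a ∈ N := H.right_mem_of_left_mem N.zero_mem (by
        rw [map_sub, map_mul, mul_sub, ← h, mul_left_comm, ← hia, smul_eq_mul, map_mul, map_zero]
        ring)
      rw [← sub_add_cancel c (r * a)]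
      exact add_mem (hNS hd) (Ideal.mul_mem_left _ _ (ih a ha hia))
  have hCS : C = Ideal.span S := by
    refine le_antisymm (fun c hc => ?_) (Ideal.span_le.2 fun c hc => hc.1)
    obtain ⟨i, hi, h⟩ := H.exists_left c hc
    exact key i hi c hc h
  rw [hCS]
  refine isExtended_span y fun s hs k => ?_
  rw [← hCS]
  have hpos : ∀ k, 1 ≤ k → (yExpand y s).coeff k ∈ C := fun k hk => H.le_right (hs.2 k hk)
  -- For `k = 0` the coefficient is what remains of `s` after subtracting the other terms.
  rcases k with _ | k
  · have hsum := eq_sum_coeff_yExpand y s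
    rw [Finset.sum_range_succ', pow_zero, mul_one] at hsum
    rw [← sub_eq_of_eq_add' hsum]
    exact C.sub_mem hs.1 (C.sum_mem fun k _ => C.mul_mem_right _ (hpos _ (Nat.le_add_left 1 k)))
  · exact hpos _ (Nat.le_add_left 1 k)

/-- The leading coefficient, as a polynomial in `y`, of an element of `I` lies in `N`, or the
element has positive degree in `y` and the coefficient lies in `C`. -/
theorem initCoeff_mem (H : IsFractionCorrespondence y I C N f g) (hC : IsExtended y C)
    {i : MvPolynomial (Fin n) κ} (hi : i ∈ I) :
    initCoeff y i ∈ N ∨ 1 ≤ i.degreeOf y ∧ initCoeff y i ∈ C := by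
  obtain ⟨c, hc, h⟩ := H.exists_right i hi
  rw [initCoeff_eq_coeff]
  by_cases hcN : c ∈ N
  · exact Or.inl (H.isExtended i (H.left_mem_of_right_mem hcN h) _)
  have hlt := H.natDegree_lt hcN h
  obtain ⟨e, he⟩ : ∃ e, i.degreeOf y = e + 1 := Nat.exists_eq_succ_of_ne_zero (by omega)
  refine Or.inr ⟨by omega, ?_⟩
  have h1 := (yExpandMod_of_mul_eq_mul H.isExtended H.num_mem H.den_mem H.initForm_num h
    (e := e) (by omega)).2
  rw [coeff_yExpandMod, coeff_yExpandMod, Ideal.Quotient.eq] at h1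
  rw [he, ← sub_add_cancel ((yExpand y i).coeff (e + 1)) ((yExpand y c).coeff e)]
  exact C.add_mem (H.le_right h1) (hC c hc e)

/-- Every polynomial `q ∈ C` not involving `y` is the coefficient of `y` in an element `y q + r`
of `I`, where `r` does not involve `y` either. -/
theorem exists_mem_left (H : IsFractionCorrespondence y I C N f g)
    {q : MvPolynomial (Fin n) κ} (hq : q ∈ C) (hqy : yExpand y q = Polynomial.C q) :
    ∃ i ∈ I, ∃ r, yExpand y i = Polynomial.C q * Polynomial.X + Polynomial.C r := by
  obtain ⟨i, hi, h⟩ := H.exists_left q hq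
  have hFq : yExpandMod y N q = Polynomial.C (Ideal.Quotient.mk N q) := by
    simp [yExpandMod, hqy]
  obtain ⟨hdeg, hcoeff⟩ := yExpandMod_of_mul_eq_mul H.isExtended H.num_mem H.den_mem
    H.initForm_num h (e := 0) (by rw [hFq, Polynomial.natDegree_C])
  set r := (yExpand y i).coeff 0 with hr
  have hexp : yExpand y (q * X y + r) =
      Polynomial.C q * Polynomial.X + Polynomial.C r := by
    rw [map_add, map_mul, hqy, yExpand_X_self, hr, yExpand_coeff_yExpand]
  refine ⟨q * X y + r, ?_, r, hexp⟩
  have hN : q * X y + r - i ∈ N := by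
    rw [← yExpandMod_eq_zero_iff H.isExtended, map_sub, sub_eq_zero,
      Polynomial.eq_X_add_C_of_natDegree_le_one hdeg, hcoeff, hFq, coeff_yExpandMod]
    change (yExpand y (q * X y + r)).map (Ideal.Quotient.mk N) = _
    rw [hexp]
    simp [← hr]
  rw [← sub_add_cancel (q * X y + r) i]
  exact I.add_mem (H.le_left hN) hi

theorem initIdeal_eq (H : IsFractionCorrespondence y I C N f g) (hC : IsExtended y C) :
    initIdeal y I = C ⊓ (N ⊔ Ideal.span {X y}) := by
  apply le_antisymm
  · refine Ideal.span_le.2 ?_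
    rintro _ ⟨i, hi, rfl⟩
    rw [SetLike.mem_coe, initForm_eq]
    rcases H.initCoeff_mem hC hi with h | ⟨hd, h⟩
    · exact Ideal.mul_mem_left _ _ ⟨H.le_right h, Ideal.mem_sup_left h⟩
    · exact ⟨Ideal.mul_mem_left _ _ h, Ideal.mem_sup_right (Ideal.mul_mem_right _ _
        (Ideal.pow_mem_of_mem _ (Ideal.mem_span_singleton_self _) _ hd))⟩
  · have hN : N ≤ initIdeal y I := fun h hh => by
      refine mem_of_coeff_yExpand_mem y fun k => Ideal.subset_span
        ⟨_, H.le_left (H.isExtended h hh k), ?_⟩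
      rw [initForm_eq, initCoeff_eq_leadingCoeff, ← natDegree_yExpand, yExpand_coeff_yExpand]
      simp
    have hyq : ∀ q ∈ C, yExpand y q = Polynomial.C q → q * X y ∈ initIdeal y I := by
      intro q hq hqy
      by_cases hq0 : q = 0
      · simp [hq0]
      obtain ⟨i, hi, r, hir⟩ := H.exists_mem_left hq hqy
      refine Ideal.subset_span ⟨i, hi, ?_⟩
      rw [initForm_eq, initCoeff_eq_leadingCoeff, ← natDegree_yExpand, hir,
        Polynomial.natDegree_linear hq0, Polynomial.leadingCoeff_linear hq0, pow_one, mul_comm]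
    rintro x ⟨hxC, hx⟩
    obtain ⟨a, ha, b, hb, rfl⟩ := Submodule.mem_sup.1 hx
    obtain ⟨z, rfl⟩ := Ideal.mem_span_singleton'.1 hb
    have hzC : z * X y ∈ C := (C.add_mem_iff_right (H.le_right ha)).1 hxC
    refine add_mem (hN ha) ?_
    have hz : ∀ k, (yExpand y z).coeff k ∈ C := fun k => by
      have := hC _ hzC (k + 1)
      rwa [map_mul, yExpand_X_self, Polynomial.coeff_mul_X] at this
    rw [eq_sum_coeff_yExpand y z, Finset.sum_mul]
    refine Ideal.sum_mem _ fun k _ => ?_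
    rw [mul_right_comm]
    exact Ideal.mul_mem_right _ _ (hyq _ (hz k) (yExpand_coeff_yExpand y z k))

theorem eq_cIdeal (H : IsFractionCorrespondence y I C N f g) (hC : IsExtended y C)
    {m : MonomialOrder.{0, v} (Fin n)} (hm : IsCompatible κ m y)
    {G : Finset (MvPolynomial (Fin n) κ)} (hG : IsGroebnerBasis m I G) : C = cIdeal y G := by
  apply le_antisymm
  · refine fun c hc => mem_of_coeff_yExpand_mem y fun k => ?_
    obtain ⟨i, hi, r, hir⟩ := H.exists_mem_left (hC c hc k) (yExpand_coeff_yExpand y c k)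
    have h := hG.coeff_yExpand_mem hm hi (k := 1) (by
      rw [← natDegree_yExpand, hir]; exact Polynomial.natDegree_linear_le)
    rw [hir] at h
    simp only [Polynomial.coeff_add, Polynomial.coeff_C_mul, Polynomial.coeff_X_one, mul_one,
      Polynomial.coeff_C_succ, add_zero] at h
    exact Ideal.span_mono (Set.image_mono (Set.sep_subset _ _)) h
  · refine Ideal.span_le.2 ?_
    rintro _ ⟨b, hb, rfl⟩
    rcases H.initCoeff_mem hC (hG.subset hb) with h | ⟨-, h⟩
    exacts [H.le_right h, h]

theorem eq_nIdeal (H : IsFractionCorrespondence y I C N f g) (hC : IsExtended y C)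
    {m : MonomialOrder.{0, v} (Fin n)} (hm : IsCompatible κ m y)
    {G : Finset (MvPolynomial (Fin n) κ)} (hG : IsGroebnerBasis m I G) : N = nIdeal y G := by
  apply le_antisymm
  · refine fun h hh => mem_of_coeff_yExpand_mem y fun k => ?_
    have h0 := hG.coeff_yExpand_mem hm (H.le_left (H.isExtended h hh k)) (k := 0) (by
      rw [← natDegree_yExpand, yExpand_coeff_yExpand, Polynomial.natDegree_C])
    simpa only [nIdeal, yExpand_coeff_yExpand, Polynomial.coeff_C_zero, Nat.le_zero] using h0
  · refine Ideal.span_le.2 ?_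
    rintro _ ⟨b, ⟨hb, hb0⟩, rfl⟩
    rcases H.initCoeff_mem hC (hG.subset hb) with h | ⟨h, -⟩
    · exact h
    · omega

end IsFractionCorrespondence

end Fraction

end GVD

theorem mainTheorem3 {κ : Type u} [Field κ] {n : ℕ} (y : Fin n)
    (m : MonomialOrder.{0, v} (Fin n)) (hm : GVD.IsCompatible κ m y)
    (I C N : Ideal (MvPolynomial (Fin n) κ)) (hN : N ≤ I ⊓ C)
    (hI : GVD.IsSquarefreeIn y I)
    (GN : Finset (MvPolynomial (Fin n) κ)) (hGN : GVD.IsReducedGroebnerBasis m N GN)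
    (hGNy : ∀ h ∈ GN, ∀ d ∈ h.support, ¬ 1 ≤ d y)
    (f g : MvPolynomial (Fin n) κ)
    (hf : Ideal.Quotient.mk N f ∈ nonZeroDivisors (MvPolynomial (Fin n) κ ⧸ N))
    (hg : Ideal.Quotient.mk N g ∈ nonZeroDivisors (MvPolynomial (Fin n) κ ⧸ N))
    (hfg : GVD.initForm y f = MvPolynomial.X y * g)
    (φ : C.map (Ideal.Quotient.mk N) ≃ₗ[MvPolynomial (Fin n) κ ⧸ N]
      I.map (Ideal.Quotient.mk N))
    (hφ : GVD.IsMulByFraction φ f g) :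
    GVD.IsGeometricVertexDecomposition.{u, v} y I C N := by
  have hNy : GVD.IsExtended y N := by
    rw [← hGN.span_eq]
    refine GVD.isExtended_span y fun h hh k => ?_
    have h0 : h.degreeOf y = 0 := Nat.le_zero.1
      (degreeOf_le_iff.2 fun d hd => Nat.le_of_lt_succ (not_le.1 (hGNy h hh d hd)))
    rw [GVD.yExpand_eq_C_of_degreeOf_eq_zero y h0, Polynomial.coeff_C]
    split_ifs
    exacts [Ideal.subset_span hh, Ideal.zero_mem _]
  have H := GVD.isFractionCorrespondence_of_isMulByFraction (hN.trans inf_le_left)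
    (hN.trans inf_le_right) hNy hf hg hfg φ hφ
  have hC := H.isExtended_right hI
  exact ⟨H.initIdeal_eq hC, fun m' hm' G hG => ⟨H.eq_cIdeal hC hm' hG, H.eq_nIdeal hC hm' hG⟩⟩
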